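/- **Theorem 1 (Convergence with known network size).** Let $\mathcal G=(\mathcal V,\mathcal E)$, $\mathcal V=\{1,\dots,N\}$, be a directed graph without self-loops in which every node has at least one outgoing link. Let $D_i\ge 1$ be the out-degree of node $i$, and let $W\in\mathbb R^{N\times N}$ be the hyperlink matrix, $w_{ij}=1/D_j$ if $(j,i)\in\mathcal E$ and $w_{ij}=0$ otherwise. Fix $m\in(0,1)$, put $M=(1-m)W+\frac mN\mathbf 1\mathbf 1^T$, and let the PageRank vector be the solution $x\in\mathbb R^N$ of $x=Mx$, $\mathbf 1^Tx=1$. Let $H_i=e_i-(1-m)W_i$, where $e_i$ and $W_i$ are the $i$-th rows of the identity matrix and of $W$, and let $y_i=m/N$. Fix $\omega\in[0,1]$, and let $s(0),s(1),\dots$ be a Markov chain on $\mathcal V$, with arbitrary initial distribution and with transition matrix $P=(1-\omega)P^W+\frac{\omega}{N}\mathbf 1\mathbf 1^T$, where $P^W$ is the Metropolis–Hastings matrix $$P^W_{ij}=\begin{cases}\min\{\frac1{D_i+1},\frac1{D_j+1}\}&\text{if }(i,j)\in\mathcal E,\\ 1-\sum_{(i,k)\in\mathcal E}P^W_{ik}&\text{if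 }i=j,\\ 0&\text{otherwise.}\end{cases}$$ If $\omega=0$, assume that $\mathcal G$ is strongly connected. Let $x(0)=0$ and $$x(k+1)=x(k)+\tfrac1N H_{s(k)}^T\bigl(y_{s(k)}-H_{s(k)}x(k)\bigr),\qquad k\ge 0.$$ Then the PageRank vector $x$ exists and is unique, and the following hold. (a) There exist (deterministic) $M_1>0$ and $\rho_1\in(0,1)$ such that, with probability one, there is a $k_0>0$ (depending on the realization) with $\|x(k)-x\|_2\le M_1\rho_1^k$ for all $k>k_0$. (b) For every $p\in[1,2]$ there exist $M_2>0$ and $\rho_2\in(0,1)$ such that $\|x(k)-x\|_{L^p}\le M_2\rho_2^k$ for all $k>0$, where $\|v\|_{L^p}=\bigl(\mathbb E\sum_{i=1}^N|v_i|^p\bigr)^{1/p}$ for a random vector $v$. -/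

import Mathlib

open scoped ENNReal

noncomputable section

namespace PageRank

variable {N : ℕ}

/-- Out-degree `D_i`: the number of links leaving node `i`. -/
def outDeg (G : Digraph (Fin N)) [DecidableRel G.Adj] (i : Fin N) : ℕ :=
  (Finset.univ.filter fun j => G.Adj i j).card

/-- Every node is reachable from every other one along a forward path. -/
def StronglyConnected (G : Digraph (Fin N)) : Prop :=
  ∀ i j : Fin N, i ≠ j → Relation.TransGen G.Adj i j

/-- The hyperlink matrix: `W i j = 1 / D_j` if `j` links to `i`, and `0` otherwise. -/
def hyperlink (G : Digraph (Fin N)) [DecidableRel G.Adj] : Matrix (Fin N) (Fin N) ℝ :=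
  Matrix.of fun i j => if G.Adj j i then 1 / (outDeg G j : ℝ) else 0

/-- The all-ones matrix `1 1ᵀ`. -/
def onesMat (N : ℕ) : Matrix (Fin N) (Fin N) ℝ := Matrix.of fun _ _ => 1

/-- The modified hyperlink matrix `M = (1 - m) W + (m / N) 1 1ᵀ`. -/
def modHyperlink (G : Digraph (Fin N)) [DecidableRel G.Adj] (m : ℝ) :
    Matrix (Fin N) (Fin N) ℝ :=
  (1 - m) • hyperlink G + (m / N) • onesMat N

/-- The PageRank equation `x = M x`, `1ᵀ x = 1`. -/
def IsPageRank (G : Digraph (Fin N)) [DecidableRel G.Adj] (m : ℝ) (x : Fin N → ℝ) : Prop :=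
  x = (modHyperlink G m).mulVec x ∧ ∑ i, x i = 1

/-- The regression row `H_i = e_i - (1 - m) W_i`. -/
def regRow (G : Digraph (Fin N)) [DecidableRel G.Adj] (m : ℝ) (i : Fin N) : Fin N → ℝ :=
  Pi.single i 1 - (1 - m) • (hyperlink G).row i

/-- The iterates driven by a node sequence `σ`: `x(0) = 0` and
`x(k+1) = x(k) + (1/N) H_{σ(k)}ᵀ (y_{σ(k)} - H_{σ(k)} x(k))`, with `y_i = m / N` for all `i`. -/
def iter (G : Digraph (Fin N)) [DecidableRel G.Adj] (m : ℝ) (σ : ℕ → Fin N) :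
    ℕ → Fin N → ℝ
  | 0 => 0
  | k + 1 => iter G m σ k +
      ((1 / (N : ℝ)) * (m / N - regRow G m (σ k) ⬝ᵥ iter G m σ k)) • regRow G m (σ k)

/-- Off-diagonal Metropolis–Hastings weights `min {1/(D_i+1), 1/(D_j+1)}` on the links `i → j`. -/
def linkWeight (G : Digraph (Fin N)) [DecidableRel G.Adj] (i j : Fin N) : ℝ :=
  if G.Adj i j then min (1 / ((outDeg G i : ℝ) + 1)) (1 / ((outDeg G j : ℝ) + 1)) else 0

/-- The Metropolis–Hastings matrix `P^W` (of a graph without self-loops). -/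
def metropolis (G : Digraph (Fin N)) [DecidableRel G.Adj] : Matrix (Fin N) (Fin N) ℝ :=
  Matrix.of fun i j => if i = j then 1 - ∑ k, linkWeight G i k else linkWeight G i j

/-- The transition matrix `P = (1 - w) P^W + (w / N) 1 1ᵀ`. -/
def transMat (G : Digraph (Fin N)) [DecidableRel G.Adj] (w : ℝ) :
    Matrix (Fin N) (Fin N) ℝ :=
  (1 - w) • metropolis G + (w / N) • onesMat N

/-- `s` is a (time-homogeneous) Markov chain on `Fin N` with transition matrix `P` and arbitrary
initial law:
`ℙ(s₀ = i₀, …, s_{k+1} = i_{k+1}) = ℙ(s₀ = i₀, …, s_k = i_k) · P_{i_k, i_{k+1}}`. -/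
structure IsMarkovChain {Ω : Type*} [MeasurableSpace Ω] (μ : MeasureTheory.Measure Ω)
    (P : Matrix (Fin N) (Fin N) ℝ) (s : ℕ → Ω → Fin N) : Prop where
  measurable : ∀ k, Measurable (s k)
  transition : ∀ (k : ℕ) (i : ℕ → Fin N),
    μ.real {a | ∀ t ≤ k + 1, s t a = i t} =
      μ.real {a | ∀ t ≤ k, s t a = i t} * P (i k) (i (k + 1))

end PageRank

end

/-!
The error `x(k) - x` evolves by the relaxed projections `v ↦ v - (1/N) ⟪H_i, v⟫ H_i`. Since
`‖H_i‖² ≤ N`, each of them strictly shortens every vector that it moves, and the vectors that it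
fixes are those orthogonal to `H_i`. The `H_i` are the rows of `I - (1 - m) W`, which is invertible
because its columns are strictly diagonally dominant, so a nonzero error is moved by some node, and
an irreducible chain reaches that node with positive probability. Compactness of the unit sphere
turns the resulting strict decrease of the expected squared error into a uniform contraction over a
fixed number of steps. Exponential decay in mean square follows; Markov's inequality and the
Borel–Cantelli lemma give (a), and monotonicity of `L^p` norms on a probability space gives (b).
-/

namespace Kaczmarz

open Filter MeasureTheory Topology

section Paracontracting

variable {E : Type*} [NormedAddCommGroup E]

/-- A linear map is paracontracting if it strictly shortens every vector that it moves. A product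
of such maps can contract although each of them has nonzero fixed vectors. -/
def IsParacontracting [NormedSpace ℝ E] (T : E →L[ℝ] E) : Prop :=
  ∀ v, T v ≠ v → ‖T v‖ < ‖v‖

theorem IsParacontracting.norm_le [NormedSpace ℝ E] {T : E →L[ℝ] E} (hT : IsParacontracting T)
    (v : E) : ‖T v‖ ≤ ‖v‖ := by
  by_cases hv : T v = v
  · rw [hv]
  · exact (hT v hv).le

variable [InnerProductSpace ℝ E]

/-- The relaxed projection `v ↦ v - η ⟪h, v⟫ h` towards the hyperplane orthogonal to `h`: the effect
on the error of one Kaczmarz step with row `h` and step size `η`. -/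
noncomputable def relaxedProjection (η : ℝ) (h : E) : E →L[ℝ] E :=
  ContinuousLinearMap.id ℝ E - (η • innerSL ℝ h).smulRight h

theorem relaxedProjection_apply (η : ℝ) (h v : E) :
    relaxedProjection η h v = v - (η * inner ℝ h v) • h := by
  simp [relaxedProjection]

theorem norm_sq_relaxedProjection (η : ℝ) (h v : E) :
    ‖relaxedProjection η h v‖ ^ 2 = ‖v‖ ^ 2 - η * (2 - η * ‖h‖ ^ 2) * inner ℝ h v ^ 2 := by
  rw [relaxedProjection_apply, norm_sub_sq_real, norm_smul, mul_pow, Real.norm_eq_abs, sq_abs,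
    real_inner_smul_right, real_inner_comm]
  ring

theorem relaxedProjection_eq_self_iff {η : ℝ} (hη : η ≠ 0) {h v : E} :
    relaxedProjection η h v = v ↔ inner ℝ h v = 0 := by
  rw [relaxedProjection_apply, sub_eq_self, smul_eq_zero, mul_eq_zero, or_iff_right hη,
    or_iff_left_of_imp]
  rintro rfl
  exact inner_zero_left v

theorem isParacontracting_relaxedProjection {η : ℝ} (hη : 0 < η) {h : E} (hh : η * ‖h‖ ^ 2 < 2) :
    IsParacontracting (relaxedProjection η h) := by
  intro v hv
  rw [Ne, relaxedProjection_eq_self_iff hη.ne'] at hv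
  have hgain : 0 < η * (2 - η * ‖h‖ ^ 2) * inner ℝ h v ^ 2 :=
    mul_pos (mul_pos hη (sub_pos.2 hh)) (by positivity)
  refine lt_of_pow_lt_pow_left₀ 2 (norm_nonneg v) ?_
  rw [norm_sq_relaxedProjection]
  linarith

end Paracontracting

section Trajectory

variable {ι E : Type*} [NormedAddCommGroup E] [NormedSpace ℝ E]

/-- The vector `T (σ (k - 1)) (⋯ (T (σ 0) v))` obtained by applying the maps `T i` along `σ`. -/
def trajectory (T : ι → E →L[ℝ] E) (v : E) (σ : ℕ → ι) : ℕ → E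
  | 0 => v
  | k + 1 => T (σ k) (trajectory T v σ k)

theorem dependsOn_trajectory (T : ι → E →L[ℝ] E) (v : E) (k : ℕ) :
    DependsOn (fun σ => trajectory T v σ k) (Set.Iio k) := by
  induction k with
  | zero => exact fun _ _ _ => rfl
  | succ k ih =>
    intro σ τ h
    simp only [trajectory, h k (Set.mem_Iio.2 k.lt_succ_self),
      ih fun t ht => h t (Set.mem_Iio.2 (Nat.lt_succ_of_lt ht))]

end Trajectory

theorem exists_le_mul_pow_of_antitone_of_add_le {L : ℕ} (hL : 0 < L) {q : ℝ}
    (hq : q ∈ Set.Ioo (0 : ℝ) 1) :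
    ∃ C > (0 : ℝ), ∃ r ∈ Set.Ioo (0 : ℝ) 1, ∀ u : ℕ → ℝ, 0 ≤ u 0 → Antitone u →
      (∀ n, u (n + L) ≤ q * u n) → ∀ n, u n ≤ C * r ^ n * u 0 := by
  obtain ⟨hq₀, hq₁⟩ := hq
  obtain ⟨r, ⟨hr₀, hr₁⟩, hrL⟩ : ∃ r ∈ Set.Ioo (0 : ℝ) 1, r ^ L = q :=
    ⟨q ^ (L : ℝ)⁻¹, ⟨Real.rpow_pos_of_pos hq₀ _, Real.rpow_lt_one hq₀.le hq₁ (by positivity)⟩,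
      Real.rpow_inv_natCast_pow hq₀.le hL.ne'⟩
  refine ⟨q⁻¹, inv_pos.2 hq₀, r, ⟨hr₀, hr₁⟩, fun u hu₀ hu hstep n => ?_⟩
  induction n using Nat.strong_induction_on with
  | _ n ih =>
    rcases lt_or_ge n L with hn | hn
    · have hrn : q ≤ r ^ n := hrL ▸ pow_le_pow_of_le_one hr₀.le hr₁.le hn.le
      calc u n ≤ 1 * u 0 := by simpa only [one_mul] using hu n.zero_le
        _ ≤ q⁻¹ * r ^ n * u 0 := by
            gcongr
            exact (one_le_inv_mul₀ hq₀).2 hrn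
    · obtain ⟨n, rfl⟩ := Nat.exists_eq_add_of_le' hn
      calc u (n + L) ≤ q * u n := hstep n
        _ ≤ q * (q⁻¹ * r ^ n * u 0) := by
            gcongr
            exact ih n (by omega)
        _ = q⁻¹ * r ^ (n + L) * u 0 := by
            rw [pow_add, hrL]
            ring

section Energy

variable {ι E : Type*} [Fintype ι] [NormedAddCommGroup E] [NormedSpace ℝ E]
  {P : Matrix ι ι ℝ} {T : ι → E →L[ℝ] E}

/-- The expectation of `‖trajectory T v σ n‖ ^ 2` over the paths `σ` from `i` of a Markov chain with
transition matrix `P`, computed by conditioning on the first step. -/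
def energy (P : Matrix ι ι ℝ) (T : ι → E →L[ℝ] E) : ℕ → ι → E → ℝ
  | 0, _, v => ‖v‖ ^ 2
  | n + 1, i, v => ∑ j, P i j * energy P T n j (T i v)

theorem energy_smul (c : ℝ) (n : ℕ) (i : ι) (v : E) :
    energy P T n i (c • v) = c ^ 2 * energy P T n i v := by
  induction n generalizing i v with
  | zero => simp only [energy, norm_smul, mul_pow, Real.norm_eq_abs, sq_abs]
  | succ n ih =>
    simp only [energy, map_smul, ih, Finset.mul_sum]
    exact Finset.sum_congr rfl fun j _ => mul_left_comm _ _ _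

theorem continuous_energy (n : ℕ) (i : ι) : Continuous (energy P T n i) := by
  induction n generalizing i with
  | zero => exact continuous_norm.pow 2
  | succ n ih =>
    exact continuous_finsetSum _ fun j _ => continuous_const.mul ((ih j).comp (T i).continuous)

theorem energy_add_le (hP : ∀ i j, 0 ≤ P i j) {b : ℕ} {c : ℝ}
    (hb : ∀ i v, energy P T b i v ≤ c * ‖v‖ ^ 2) (a : ℕ) (i : ι) (v : E) :
    energy P T (a + b) i v ≤ c * energy P T a i v := by
  induction a generalizing i v with
  | zero => simpa only [Nat.zero_add, energy] using hb i v
  | succ a ih =>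
    rw [Nat.add_right_comm]
    simp only [energy, Finset.mul_sum, mul_left_comm c]
    exact Finset.sum_le_sum fun j _ => mul_le_mul_of_nonneg_left (ih j _) (hP i j)

variable [DecidableEq ι]

theorem energy_one (hP : P ∈ Matrix.rowStochastic ℝ ι) (i : ι) (v : E) :
    energy P T 1 i v = ‖T i v‖ ^ 2 := by
  simp only [energy, ← Finset.sum_mul, Matrix.sum_row_of_mem_rowStochastic hP, one_mul]

theorem antitone_energy (hP : P ∈ Matrix.rowStochastic ℝ ι) (hT : ∀ i, IsParacontracting (T i))
    (i : ι) (v : E) : Antitone fun n => energy P T n i v := by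
  have hone (i : ι) (v : E) : energy P T 1 i v ≤ 1 * ‖v‖ ^ 2 := by
    rw [energy_one hP, one_mul]
    gcongr
    exact (hT i).norm_le v
  refine antitone_nat_of_succ_le fun n => ?_
  simpa only [one_mul] using energy_add_le hP.1 hone n i v

theorem energy_le_norm_sq (hP : P ∈ Matrix.rowStochastic ℝ ι) (hT : ∀ i, IsParacontracting (T i))
    (n : ℕ) (i : ι) (v : E) : energy P T n i v ≤ ‖v‖ ^ 2 :=
  antitone_energy hP hT i v n.zero_le

theorem energy_lt_of_pow_pos (hP : P ∈ Matrix.rowStochastic ℝ ι)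
    (hT : ∀ i, IsParacontracting (T i)) {k : ℕ} {i j : ι} {v : E} (hij : 0 < (P ^ k) i j)
    (hv : T j v ≠ v) : energy P T (k + 1) i v < ‖v‖ ^ 2 := by
  induction k generalizing i with
  | zero =>
    obtain rfl : i = j := by
      by_contra hne
      simp [Matrix.one_apply_ne hne] at hij
    rw [energy_one hP]
    gcongr
    exact hT i v hv
  | succ k ih =>
    by_cases hi : T i v = v
    · obtain ⟨c, -, hc⟩ : ∃ c ∈ Finset.univ, 0 < P i c * (P ^ k) c j := by
        rwa [pow_succ', Matrix.mul_apply, Finset.sum_pos_iff_of_nonneg fun c _ =>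
          mul_nonneg (hP.1 i c) ((pow_mem hP k).1 c j)] at hij
      have hic : 0 < P i c := (hP.1 i c).lt_of_ne' (left_ne_zero_of_mul hc.ne')
      calc energy P T (k + 2) i v = ∑ b, P i b * energy P T (k + 1) b v := by rw [energy, hi]
        _ < ∑ b, P i b * ‖v‖ ^ 2 :=
            Finset.sum_lt_sum
              (fun b _ => mul_le_mul_of_nonneg_left (energy_le_norm_sq hP hT _ b v) (hP.1 i b))
              ⟨c, Finset.mem_univ c,
                mul_lt_mul_of_pos_left (ih (pos_of_mul_pos_right hc hic.le)) hic⟩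
        _ = ‖v‖ ^ 2 := by
            rw [← Finset.sum_mul, Matrix.sum_row_of_mem_rowStochastic hP, one_mul]
    · calc energy P T (k + 2) i v ≤ energy P T 1 i v := antitone_energy hP hT i v (by omega)
        _ = ‖T i v‖ ^ 2 := energy_one hP i v
        _ < ‖v‖ ^ 2 := by
            gcongr
            exact hT i v hi

theorem exists_energy_lt (hP : P ∈ Matrix.rowStochastic ℝ ι) (hirr : P.IsIrreducible)
    (hT : ∀ i, IsParacontracting (T i)) (hfix : ∀ v, (∀ i, T i v = v) → v = 0) (i : ι) {v : E}
    (hv : v ≠ 0) : ∃ n, energy P T n i v < ‖v‖ ^ 2 := by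
  obtain ⟨j, hj⟩ : ∃ j, T j v ≠ v := by
    contrapose! hv
    exact hfix v hv
  obtain ⟨k, -, hk⟩ := (Matrix.isIrreducible_iff_exists_pow_pos hP.1).1 hirr i j
  exact ⟨k + 1, energy_lt_of_pow_pos hP hT hk hj⟩

theorem exists_forall_unit_energy_lt [FiniteDimensional ℝ E] (hP : P ∈ Matrix.rowStochastic ℝ ι)
    (hirr : P.IsIrreducible) (hT : ∀ i, IsParacontracting (T i))
    (hfix : ∀ v, (∀ i, T i v = v) → v = 0) :
    ∃ L : ℕ, ∀ v : E, ‖v‖ = 1 → ∀ i, energy P T L i v < 1 - 1 / ((L : ℝ) + 1) := by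
  have hanti : Antitone fun n : ℕ => 1 / ((n : ℝ) + 1) := fun _ _ => Nat.one_div_le_one_div
  have hlim : Tendsto (fun n : ℕ => 1 - 1 / ((n : ℝ) + 1)) atTop (𝓝 1) := by
    simpa using tendsto_one_div_add_atTop_nhds_zero_nat.const_sub (1 : ℝ)
  -- A threshold that increases to `1` makes one compactness argument yield both the number of
  -- steps and the contraction factor.
  let U (n : ℕ) : Set E := {v | ∀ i, energy P T n i v < 1 - 1 / ((n : ℝ) + 1)}
  have hUo (n : ℕ) : IsOpen (U n) := by
    simp only [U, Set.ofPred_forall]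
    exact isOpen_iInter_of_finite fun i => isOpen_lt (continuous_energy n i) continuous_const
  have hUm : Monotone U := fun a b hab v hv i =>
    ((antitone_energy hP hT i v hab).trans_lt (hv i)).trans_le (sub_le_sub_left (hanti hab) 1)
  have hcover : Metric.sphere (0 : E) 1 ⊆ ⋃ n, U n := by
    intro v hv
    have hv₀ : v ≠ 0 := ne_zero_of_mem_unit_sphere ⟨v, hv⟩
    rw [mem_sphere_zero_iff_norm] at hv
    have hev (i : ι) : ∀ᶠ n : ℕ in atTop, energy P T n i v < 1 - 1 / ((n : ℝ) + 1) := by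
      obtain ⟨n₀, hn₀⟩ := exists_energy_lt hP hirr hT hfix i hv₀
      rw [hv, one_pow] at hn₀
      filter_upwards [hlim.eventually (lt_mem_nhds hn₀), eventually_ge_atTop n₀] with n hn hle
      exact (antitone_energy hP hT i v hle).trans_lt hn
    exact Set.mem_iUnion.2 (eventually_all.2 hev).exists
  obtain ⟨L, hL⟩ := (isCompact_sphere (0 : E) 1).elim_directed_cover U hUo hcover hUm.directed_le
  exact ⟨L, fun v hv => hL (mem_sphere_zero_iff_norm.2 hv)⟩

theorem exists_energy_le_mul [FiniteDimensional ℝ E] (hP : P ∈ Matrix.rowStochastic ℝ ι)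
    (hirr : P.IsIrreducible) (hT : ∀ i, IsParacontracting (T i))
    (hfix : ∀ v, (∀ i, T i v = v) → v = 0) :
    ∃ L > 0, ∃ q ∈ Set.Ioo (0 : ℝ) 1, ∀ i (v : E), energy P T L i v ≤ q * ‖v‖ ^ 2 := by
  obtain ⟨L, hL⟩ := exists_forall_unit_energy_lt hP hirr hT hfix
  have hq : 1 - 1 / ((L : ℝ) + 1) ≤ 1 - 1 / ((L : ℝ) + 2) := by
    gcongr
    norm_num
  refine ⟨L + 1, L.succ_pos, 1 - 1 / ((L : ℝ) + 2), ⟨?_, ?_⟩, fun i v => ?_⟩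
  · rw [sub_pos, div_lt_one (by positivity)]
    linarith [(L.cast_nonneg : (0 : ℝ) ≤ L)]
  · exact sub_lt_self 1 (by positivity)
  rcases eq_or_ne v 0 with rfl | hv
  · simpa using energy_le_norm_sq hP hT (L + 1) i (0 : E)
  have hv' : ‖v‖ ≠ 0 := norm_ne_zero_iff.2 hv
  have hunit : energy P T L i (‖v‖⁻¹ • v) < 1 - 1 / ((L : ℝ) + 1) :=
    hL _ (by rw [norm_smul, norm_inv, norm_norm, inv_mul_cancel₀ hv']) i
  calc energy P T (L + 1) i v ≤ energy P T L i v := antitone_energy hP hT i v L.le_succ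
    _ = energy P T L i (‖v‖⁻¹ • v) * ‖v‖ ^ 2 := by
        rw [mul_comm, ← energy_smul, smul_inv_smul₀ hv']
    _ ≤ (1 - 1 / ((L : ℝ) + 2)) * ‖v‖ ^ 2 := by
        gcongr
        exact hunit.le.trans hq

theorem exists_energy_le_mul_pow [FiniteDimensional ℝ E] (hP : P ∈ Matrix.rowStochastic ℝ ι)
    (hirr : P.IsIrreducible) (hT : ∀ i, IsParacontracting (T i))
    (hfix : ∀ v, (∀ i, T i v = v) → v = 0) :
    ∃ C > (0 : ℝ), ∃ r ∈ Set.Ioo (0 : ℝ) 1, ∀ n i (v : E),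
      energy P T n i v ≤ C * r ^ n * ‖v‖ ^ 2 := by
  obtain ⟨L, hL, q, hq, hcontr⟩ := exists_energy_le_mul hP hirr hT hfix
  obtain ⟨C, hC, r, hr, hgeom⟩ := exists_le_mul_pow_of_antitone_of_add_le hL hq
  exact ⟨C, hC, r, hr, fun n i v => hgeom (fun n => energy P T n i v) (sq_nonneg _)
    (antitone_energy hP hT i v) (fun n => energy_add_le hP.1 hcontr n i v) n⟩

end Energy

section Decay

variable {Ω : Type*} [MeasurableSpace Ω] {μ : Measure Ω}

theorem exists_ae_eventually_le_pow [IsFiniteMeasure μ] {f : ℕ → Ω → ℝ}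
    (hf : ∀ k, Integrable (fun a => f k a ^ 2) μ) {A r : ℝ} (hr : r ∈ Set.Ioo (0 : ℝ) 1)
    (hA : ∀ k, ∫ a, f k a ^ 2 ∂μ ≤ A * r ^ k) :
    ∃ ρ ∈ Set.Ioo (0 : ℝ) 1, ∀ᵐ a ∂μ, ∀ᶠ k in atTop, f k a ≤ ρ ^ k := by
  obtain ⟨ρ, hrρ, hρ₁⟩ : ∃ ρ, √r < ρ ∧ ρ < 1 :=
    exists_between ((Real.sqrt_lt' one_pos).2 (by simpa using hr.2))
  have hρ₀ : 0 < ρ := (Real.sqrt_nonneg r).trans_lt hrρ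
  have hquot : |r / ρ ^ 2| < 1 := by
    rw [abs_of_pos (div_pos hr.1 (by positivity)), div_lt_one (by positivity)]
    exact Real.lt_sq_of_sqrt_lt hrρ
  have htail (k : ℕ) : μ {a | ρ ^ k ≤ f k a} ≤ ENNReal.ofReal (A * (r / ρ ^ 2) ^ k) := by
    have hmarkov := (mul_meas_ge_le_integral_of_nonneg (.of_forall fun a => sq_nonneg (f k a))
      (hf k) ((ρ ^ k) ^ 2)).trans (hA k)
    calc μ {a | ρ ^ k ≤ f k a} ≤ μ {a | (ρ ^ k) ^ 2 ≤ f k a ^ 2} :=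
          measure_mono fun a ha => Set.mem_ofPred.2 (pow_le_pow_left₀ (by positivity) ha 2)
      _ = ENNReal.ofReal (μ.real {a | (ρ ^ k) ^ 2 ≤ f k a ^ 2}) := (ofReal_measureReal).symm
      _ ≤ ENNReal.ofReal (A * (r / ρ ^ 2) ^ k) := by
          refine ENNReal.ofReal_le_ofReal ?_
          rwa [div_pow, ← mul_div_assoc, le_div_iff₀' (by positivity), pow_right_comm]
  have hsum : ∑' k, μ {a | ρ ^ k ≤ f k a} ≠ ∞ :=
    ne_top_of_le_ne_top ((summable_geometric_of_abs_lt_one hquot).mul_left A).tsum_ofReal_ne_top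
      (ENNReal.tsum_le_tsum htail)
  refine ⟨ρ, ⟨hρ₀, hρ₁⟩, ?_⟩
  filter_upwards [ae_eventually_notMem hsum] with a ha
  exact ha.mono fun k hk => (not_le.1 hk).le

theorem eLpNorm_le_ofReal_of_integral_sq_le [IsProbabilityMeasure μ] {f : Ω → ℝ}
    (hfm : AEStronglyMeasurable f μ) (hf : Integrable (fun a => f a ^ 2) μ) {b : ℝ} (hb : 0 ≤ b)
    (hfb : ∫ a, f a ^ 2 ∂μ ≤ b ^ 2) {p : ℝ≥0∞} (hp : p ≤ 2) :
    eLpNorm f p μ ≤ ENNReal.ofReal b := by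
  calc eLpNorm f p μ ≤ eLpNorm f 2 μ := eLpNorm_le_eLpNorm_of_exponent_le hp hfm
    _ = ENNReal.ofReal √(∫ a, f a ^ 2 ∂μ) := by
        rw [((memLp_two_iff_integrable_sq hfm).2 hf).eLpNorm_eq_integral_rpow_norm two_ne_zero
          ENNReal.ofNat_ne_top, Real.sqrt_eq_rpow]
        simp
    _ ≤ ENNReal.ofReal b := ENNReal.ofReal_le_ofReal ((Real.sqrt_le_left hb).2 hfb)

end Decay

end Kaczmarz

namespace PageRank

open Kaczmarz MeasureTheory

section MarkovChain

variable {N : ℕ} {Ω : Type*} [MeasurableSpace Ω] {μ : Measure Ω}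
  {P : Matrix (Fin N) (Fin N) ℝ} {s : ℕ → Ω → Fin N}

theorem integral_comp_eq_sum {α : Type*} [Fintype α] [MeasurableSpace α]
    [MeasurableSingletonClass α] [IsFiniteMeasure μ] {Y : Ω → α} (hY : Measurable Y) (F : α → ℝ) :
    ∫ a, F (Y a) ∂μ = ∑ c, μ.real (Y ⁻¹' {c}) * F c := by
  rw [← integral_map hY.aemeasurable (measurable_of_finite F).aestronglyMeasurable,
    integral_fintype .of_finite]
  simp only [map_measureReal_apply hY (measurableSet_singleton _), smul_eq_mul]

/-- The path of a process up to and including time `k`. -/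
def past (s : ℕ → Ω → Fin N) (k : ℕ) (a : Ω) : Set.Iic k → Fin N :=
  (Set.Iic k).domRestrict fun t => s t a

namespace IsMarkovChain

theorem measurable_past (hs : IsMarkovChain μ P s) (k : ℕ) : Measurable (past s k) :=
  measurable_pi_lambda _ fun t => hs.measurable t

theorem integrable_comp [IsFiniteMeasure μ] (hs : IsMarkovChain μ P s) {k : ℕ}
    {F : (ℕ → Fin N) → ℝ} (hF : DependsOn F (Set.Iic k)) :
    Integrable (fun a => F fun t => s t a) μ := by
  obtain ⟨F', rfl⟩ := dependsOn_iff_exists_comp.1 hF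
  exact (Integrable.of_finite (f := F')).comp_measurable (hs.measurable_past k)

theorem measureReal_past_succ (hs : IsMarkovChain μ P s) (k : ℕ) (c : Set.Iic k → Fin N)
    (j : Fin N) :
    μ.real ((fun a => (past s k a, s (k + 1) a)) ⁻¹' {(c, j)}) =
      μ.real (past s k ⁻¹' {c}) * P (c ⟨k, Set.self_mem_Iic⟩) j := by
  let i (t : ℕ) : Fin N := if ht : t ≤ k then c ⟨t, ht⟩ else j
  have hi : i (k + 1) = j := dif_neg (by omega)
  have hik : i k = c ⟨k, Set.self_mem_Iic⟩ := dif_pos le_rfl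
  have hpast (a : Ω) : past s k a = c ↔ ∀ t ≤ k, s t a = i t := by
    simp only [funext_iff, Subtype.forall]
    exact forall₂_congr fun t ht => by rw [show i t = c ⟨t, ht⟩ from dif_pos ht]; rfl
  have key := hs.transition k i
  simp only [Nat.le_add_one_iff, or_imp, forall_and, forall_eq, hi, hik, ← hpast] at key
  simpa only [Set.preimage, Set.mem_singleton_iff, Prod.mk.injEq] using key

theorem integral_succ [IsFiniteMeasure μ] (hs : IsMarkovChain μ P s) {k : ℕ}
    {g : (ℕ → Fin N) → Fin N → ℝ} (hg : DependsOn g (Set.Iic k)) :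
    ∫ a, g (fun t => s t a) (s (k + 1) a) ∂μ =
      ∫ a, ∑ j, P (s k a) j * g (fun t => s t a) j ∂μ := by
  obtain ⟨g', rfl⟩ := dependsOn_iff_exists_comp.1 hg
  have hpast := hs.measurable_past k
  calc ∫ a, g' (past s k a) (s (k + 1) a) ∂μ
      = ∑ c, ∑ j, μ.real ((fun a => (past s k a, s (k + 1) a)) ⁻¹' {(c, j)}) * g' c j := by
        rw [integral_comp_eq_sum (hpast.prodMk (hs.measurable (k + 1))) fun z => g' z.1 z.2,
          Fintype.sum_prod_type]
    _ = ∑ c, μ.real (past s k ⁻¹' {c}) * ∑ j, P (c ⟨k, Set.self_mem_Iic⟩) j * g' c j := by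
        simp only [hs.measureReal_past_succ, Finset.mul_sum, mul_assoc]
    _ = ∫ a, ∑ j, P (s k a) j * g' (past s k a) j ∂μ :=
        (integral_comp_eq_sum hpast fun c => ∑ j, P (c ⟨k, Set.self_mem_Iic⟩) j * g' c j).symm

variable {E : Type*} [NormedAddCommGroup E] [NormedSpace ℝ E] {T : Fin N → E →L[ℝ] E}

theorem integral_energy_trajectory [IsFiniteMeasure μ] (hs : IsMarkovChain μ P s) (v : E)
    (n k : ℕ) :
    ∫ a, energy P T n (s k a) (trajectory T v (fun t => s t a) k) ∂μ =
      ∫ a, energy P T (n + k) (s 0 a) v ∂μ := by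
  induction k generalizing n with
  | zero => rfl
  | succ k ih =>
    have hdep : DependsOn (fun σ j => energy P T n j (trajectory T v σ (k + 1)))
        (Set.Iic k) := fun σ τ h => by
      simp only [dependsOn_trajectory T v (k + 1) fun t ht => h t (Nat.le_of_lt_succ ht)]
    calc ∫ a, energy P T n (s (k + 1) a)
          (trajectory T v (fun t => s t a) (k + 1)) ∂μ
        = ∫ a, energy P T (n + 1) (s k a)
            (trajectory T v (fun t => s t a) k) ∂μ := hs.integral_succ hdep
      _ = ∫ a, energy P T (n + (k + 1)) (s 0 a) v ∂μ := by
          rw [ih, Nat.add_assoc, Nat.add_comm 1]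

theorem exists_integral_norm_sq_trajectory_le [FiniteDimensional ℝ E] [IsProbabilityMeasure μ]
    (hs : IsMarkovChain μ P s) (hP : P ∈ Matrix.rowStochastic ℝ (Fin N)) (hirr : P.IsIrreducible)
    (hT : ∀ i, IsParacontracting (T i)) (hfix : ∀ v, (∀ i, T i v = v) → v = 0) (v : E) :
    ∃ A > (0 : ℝ), ∃ r ∈ Set.Ioo (0 : ℝ) 1, ∀ k,
      ∫ a, ‖trajectory T v (fun t => s t a) k‖ ^ 2 ∂μ ≤ A * r ^ k := by
  obtain ⟨C, hC, r, hr, hdecay⟩ := exists_energy_le_mul_pow hP hirr hT hfix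
  refine ⟨C * (‖v‖ ^ 2 + 1), by positivity, r, hr, fun k => ?_⟩
  have hint : Integrable (fun a => energy P T k (s 0 a) v) μ :=
    hs.integrable_comp (k := 0) (F := fun σ => energy P T k (σ 0) v)
      fun σ τ h => by simp only [h 0 Set.self_mem_Iic]
  calc ∫ a, ‖trajectory T v (fun t => s t a) k‖ ^ 2 ∂μ
      = ∫ a, energy P T k (s 0 a) v ∂μ := by
        simpa only [Nat.zero_add, energy] using hs.integral_energy_trajectory (T := T) v 0 k
    _ ≤ ∫ _, C * (‖v‖ ^ 2 + 1) * r ^ k ∂μ := by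
        refine integral_mono hint (integrable_const _) fun a => (hdecay k (s 0 a) v).trans ?_
        rw [mul_right_comm]
        have := hr.1
        gcongr
        exact le_add_of_nonneg_right zero_le_one
    _ = C * (‖v‖ ^ 2 + 1) * r ^ k := by simp

theorem integrable_comp_trajectory [IsFiniteMeasure μ] (hs : IsMarkovChain μ P s) (v : E) (k : ℕ)
    (F : E → ℝ) : Integrable (fun a => F (trajectory T v (fun t => s t a) k)) μ :=
  hs.integrable_comp (F := fun σ => F (trajectory T v σ k)) fun _ _ h =>
    congrArg F (dependsOn_trajectory T v k fun t ht => h t (Set.Iio_subset_Iic_self ht))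

theorem exists_ae_eventually_norm_trajectory_le [FiniteDimensional ℝ E] [IsProbabilityMeasure μ]
    (hs : IsMarkovChain μ P s) (hP : P ∈ Matrix.rowStochastic ℝ (Fin N)) (hirr : P.IsIrreducible)
    (hT : ∀ i, IsParacontracting (T i)) (hfix : ∀ v, (∀ i, T i v = v) → v = 0) (v : E) :
    ∃ ρ ∈ Set.Ioo (0 : ℝ) 1, ∀ᵐ a ∂μ, ∀ᶠ k in Filter.atTop,
      ‖trajectory T v (fun t => s t a) k‖ ≤ ρ ^ k := by
  obtain ⟨A, -, r, hr, hdecay⟩ := hs.exists_integral_norm_sq_trajectory_le hP hirr hT hfix v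
  exact exists_ae_eventually_le_pow
    (fun k => hs.integrable_comp_trajectory v k fun y => ‖y‖ ^ 2) hr hdecay

theorem exists_eLpNorm_norm_trajectory_le [FiniteDimensional ℝ E] [IsProbabilityMeasure μ]
    (hs : IsMarkovChain μ P s) (hP : P ∈ Matrix.rowStochastic ℝ (Fin N)) (hirr : P.IsIrreducible)
    (hT : ∀ i, IsParacontracting (T i)) (hfix : ∀ v, (∀ i, T i v = v) → v = 0) (v : E) :
    ∃ M > (0 : ℝ), ∃ ρ ∈ Set.Ioo (0 : ℝ) 1, ∀ k, ∀ p ≤ (2 : ℝ≥0∞),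
      eLpNorm (fun a => ‖trajectory T v (fun t => s t a) k‖) p μ ≤ ENNReal.ofReal (M * ρ ^ k) := by
  obtain ⟨A, hA, r, ⟨hr₀, hr₁⟩, hdecay⟩ :=
    hs.exists_integral_norm_sq_trajectory_le hP hirr hT hfix v
  refine ⟨√A, Real.sqrt_pos.2 hA, √r, ⟨Real.sqrt_pos.2 hr₀, (Real.sqrt_lt' one_pos).2 ?_⟩,
    fun k p hp => eLpNorm_le_ofReal_of_integral_sq_le
      (hs.integrable_comp_trajectory v k norm).aestronglyMeasurable
      (hs.integrable_comp_trajectory v k fun y => ‖y‖ ^ 2) (by positivity) ?_ hp⟩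
  · rwa [one_pow]
  · rw [mul_pow, Real.sq_sqrt hA.le, pow_right_comm, Real.sq_sqrt hr₀.le]
    exact hdecay k

end IsMarkovChain

end MarkovChain

end PageRank

namespace PageRank

open Filter Kaczmarz MeasureTheory
open scoped Matrix

section HyperlinkMatrix

theorem det_one_sub_smul_ne_zero {ι : Type*} [Fintype ι] [DecidableEq ι] {W : Matrix ι ι ℝ}
    (hW : W ∈ Matrix.colStochastic ℝ ι) {c : ℝ} (hc : |c| < 1) : (1 - c • W).det ≠ 0 := by
  refine det_ne_zero_of_sum_col_lt_diag fun k => ?_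
  calc ∑ i ∈ Finset.univ.erase k, ‖(1 - c • W) i k‖
      = ∑ i ∈ Finset.univ.erase k, |c| * W i k := by
        refine Finset.sum_congr rfl fun i hi => ?_
        simp [Matrix.one_apply_ne (Finset.ne_of_mem_erase hi), abs_of_nonneg (hW.1 i k)]
    _ = |c| - |c| * W k k := by
        rw [← Finset.mul_sum, Finset.sum_erase_eq_sub (Finset.mem_univ k),
          Matrix.sum_col_of_mem_colStochastic hW, mul_sub, mul_one]
    _ < 1 - |c| * W k k := sub_lt_sub_right hc _
    _ ≤ 1 - c * W k k := by
        gcongr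
        · exact hW.1 k k
        · exact le_abs_self c
    _ ≤ ‖(1 - c • W) k k‖ := by simpa using le_abs_self (1 - c * W k k)

variable {N : ℕ} (G : Digraph (Fin N)) [DecidableRel G.Adj]

theorem hyperlink_mem_colStochastic (h_dangling : ∀ i, ∃ j, G.Adj i j) :
    hyperlink G ∈ Matrix.colStochastic ℝ (Fin N) := by
  refine Matrix.mem_colStochastic_iff_sum.2 ⟨fun i j => ?_, fun j => ?_⟩
  · simp only [hyperlink, Matrix.of_apply]
    positivity
  · obtain ⟨k, hk⟩ := h_dangling j
    have hdeg : (outDeg G j : ℝ) ≠ 0 :=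
      Nat.cast_ne_zero.2 (Finset.card_ne_zero_of_mem (Finset.mem_filter.2 ⟨Finset.mem_univ k, hk⟩))
    simp only [hyperlink, Matrix.of_apply, ← Finset.sum_filter, Finset.sum_const, nsmul_eq_mul]
    exact mul_one_div_cancel hdeg

variable (m : ℝ)

theorem regRow_eq_row (i : Fin N) : regRow G m i = (1 - (1 - m) • hyperlink G).row i := by
  ext j
  simp [regRow, Matrix.one_apply, Pi.single_apply, eq_comm]

theorem one_sub_smul_hyperlink_mulVec (v : Fin N → ℝ) :
    (1 - (1 - m) • hyperlink G) *ᵥ v = fun i => regRow G m i ⬝ᵥ v := by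
  ext i
  rw [regRow_eq_row]
  rfl

theorem regRow_dotProduct (i : Fin N) (v : Fin N → ℝ) :
    regRow G m i ⬝ᵥ v = v i - (1 - m) * (hyperlink G *ᵥ v) i := by
  rw [← congrFun (one_sub_smul_hyperlink_mulVec G m v) i, Matrix.sub_mulVec, Matrix.one_mulVec,
    Matrix.smul_mulVec]
  rfl

theorem modHyperlink_mulVec_apply (i : Fin N) (v : Fin N → ℝ) :
    (modHyperlink G m *ᵥ v) i = (1 - m) * (hyperlink G *ᵥ v) i + m / N * ∑ j, v j := by
  simp [modHyperlink, onesMat, Matrix.mulVec, dotProduct, add_mul, Finset.sum_add_distrib,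
    Finset.mul_sum, mul_assoc]

variable {G m}

theorem det_one_sub_smul_hyperlink_ne_zero (h_dangling : ∀ i, ∃ j, G.Adj i j)
    (hm : m ∈ Set.Ioc (0 : ℝ) 1) : (1 - (1 - m) • hyperlink G).det ≠ 0 :=
  det_one_sub_smul_ne_zero (hyperlink_mem_colStochastic G h_dangling)
    (abs_lt.2 ⟨by linarith [hm.2], by linarith [hm.1]⟩)

theorem norm_sq_regRow_le (h_dangling : ∀ i, ∃ j, G.Adj i j) (hm : m ∈ Set.Icc (0 : ℝ) 1)
    (i : Fin N) : ‖WithLp.toLp 2 (regRow G m i)‖ ^ 2 ≤ N := by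
  have hW := hyperlink_mem_colStochastic G h_dangling
  have hentry (j : Fin N) : |regRow G m i j| ≤ 1 := by
    rw [regRow_eq_row]
    have hone : (1 : Matrix (Fin N) (Fin N) ℝ) i j ∈ Set.Icc 0 1 := by
      rw [Matrix.one_apply]
      split_ifs <;> norm_num
    have hc : 0 ≤ 1 - m := sub_nonneg.2 hm.2
    exact abs_sub_le_of_nonneg_of_le hone.1 hone.2 (mul_nonneg hc (hW.1 i j))
      (mul_le_one₀ (sub_le_self 1 hm.1) (hW.1 i j) (Matrix.le_one_of_mem_colStochastic hW))
  calc ‖WithLp.toLp 2 (regRow G m i)‖ ^ 2 = ∑ j, regRow G m i j ^ 2 :=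
        EuclideanSpace.real_norm_sq_eq _
    _ ≤ ∑ _j : Fin N, 1 := Finset.sum_le_sum fun j _ => (sq_le_one_iff_abs_le_one _).2 (hentry j)
    _ = N := by simp

theorem isPageRank_iff (h_dangling : ∀ i, ∃ j, G.Adj i j) (hN : 0 < N) (hm : m ≠ 0)
    {x : Fin N → ℝ} : IsPageRank G m x ↔ ∀ i, regRow G m i ⬝ᵥ x = m / N := by
  simp only [IsPageRank, funext_iff, modHyperlink_mulVec_apply, regRow_dotProduct]
  have hN' : (N : ℝ) ≠ 0 := by positivity
  constructor
  · rintro ⟨hfix, hsum⟩ i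
    rw [hsum] at hfix
    linarith [hfix i]
  · intro hreg
    have hsum : ∑ i, x i = 1 := by
      have htot := Finset.sum_congr rfl fun i (_ : i ∈ Finset.univ) => hreg i
      rw [Finset.sum_sub_distrib, ← Finset.mul_sum, Matrix.sum_mulVec_of_mem_colStochastic
        (hyperlink_mem_colStochastic G h_dangling), Finset.sum_const, Finset.card_univ,
        Fintype.card_fin, nsmul_eq_mul, mul_div_cancel₀ m hN'] at htot
      exact mul_left_cancel₀ hm (by linarith)
    refine ⟨fun i => ?_, hsum⟩
    rw [hsum]
    linarith [hreg i]

theorem existsUnique_isPageRank (h_dangling : ∀ i, ∃ j, G.Adj i j) (hN : 0 < N)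
    (hm : m ∈ Set.Ioc (0 : ℝ) 1) : ∃! x, IsPageRank G m x := by
  have hunit : IsUnit (1 - (1 - m) • hyperlink G) := (Matrix.isUnit_iff_isUnit_det _).2
    (det_one_sub_smul_hyperlink_ne_zero h_dangling hm).isUnit
  have hbij : Function.Bijective (1 - (1 - m) • hyperlink G).mulVec :=
    ⟨Matrix.mulVec_injective_iff_isUnit.2 hunit, Matrix.mulVec_surjective_iff_isUnit.2 hunit⟩
  simpa only [one_sub_smul_hyperlink_mulVec, funext_iff,
    ← isPageRank_iff h_dangling hN hm.1.ne'] using hbij.existsUnique fun _ => m / N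

end HyperlinkMatrix

section TransitionMatrix

theorem isIrreducible_of_transGen {ι : Type*} {A : Matrix ι ι ℝ} (hA : ∀ i j, 0 ≤ A i j)
    (h : ∀ i j, Relation.TransGen (fun a b => 0 < A a b) i j) : A.IsIrreducible := by
  let := A.toQuiver
  refine ⟨hA, fun i j => ?_⟩
  induction h i j with
  | single hij => exact ⟨.cons .nil ⟨hij⟩, Nat.one_pos⟩
  | tail _ hbc ih =>
    obtain ⟨q, -⟩ := ih
    exact ⟨q.cons ⟨hbc⟩, Nat.succ_pos _⟩

theorem StronglyConnected.transGen {N : ℕ} {G : Digraph (Fin N)} (hG : StronglyConnected G)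
    (h_dangling : ∀ i, ∃ j, G.Adj i j) (i j : Fin N) : Relation.TransGen G.Adj i j := by
  by_cases hij : i = j
  · obtain ⟨k, hk⟩ := h_dangling i
    by_cases hkj : k = j
    · exact .single (hkj ▸ hk)
    · exact .head hk (hG k j hkj)
  · exact hG i j hij

variable {N : ℕ} {G : Digraph (Fin N)} [DecidableRel G.Adj]

theorem linkWeight_nonneg (i j : Fin N) : 0 ≤ linkWeight G i j := by
  unfold linkWeight
  positivity

theorem linkWeight_pos {i j : Fin N} (h : G.Adj i j) : 0 < linkWeight G i j := by
  rw [linkWeight, if_pos h]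
  positivity

theorem sum_linkWeight_le_one (i : Fin N) : ∑ j, linkWeight G i j ≤ 1 := by
  calc ∑ j, linkWeight G i j ≤ ∑ j, if G.Adj i j then 1 / ((outDeg G i : ℝ) + 1) else 0 := by
        refine Finset.sum_le_sum fun j _ => ?_
        unfold linkWeight
        split_ifs
        · exact min_le_left _ _
        · exact le_rfl
    _ = outDeg G i / ((outDeg G i : ℝ) + 1) := by
        rw [← Finset.sum_filter, Finset.sum_const, nsmul_eq_mul, mul_one_div]
        rfl
    _ ≤ 1 := div_le_one_of_le₀ (le_add_of_nonneg_right zero_le_one) (by positivity)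

theorem metropolis_mem_rowStochastic (h_loop : ∀ i, ¬ G.Adj i i) :
    metropolis G ∈ Matrix.rowStochastic ℝ (Fin N) := by
  refine Matrix.mem_rowStochastic_iff_sum.2 ⟨fun i j => ?_, fun i => ?_⟩
  · simp only [metropolis, Matrix.of_apply]
    split_ifs
    · exact sub_nonneg.2 (sum_linkWeight_le_one i)
    · exact linkWeight_nonneg i j
  · have hdiag : linkWeight G i i = 0 := if_neg (h_loop i)
    simp only [metropolis, Matrix.of_apply]
    rw [Finset.sum_ite, Finset.filter_eq, if_pos (Finset.mem_univ i), Finset.sum_singleton,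
      Finset.filter_ne, Finset.sum_erase _ hdiag, sub_add_cancel]

variable (N) in
theorem inv_smul_onesMat_mem_rowStochastic :
    (N : ℝ)⁻¹ • onesMat N ∈ Matrix.rowStochastic ℝ (Fin N) := by
  refine Matrix.mem_rowStochastic_iff_sum.2 ⟨fun i j => ?_, fun i => ?_⟩
  · simp [onesMat]
  · have hN : (N : ℝ) ≠ 0 := Nat.cast_ne_zero.2 i.pos.ne'
    simp [onesMat, hN]

theorem transMat_mem_rowStochastic (h_loop : ∀ i, ¬ G.Adj i i) {w : ℝ}
    (hw : w ∈ Set.Icc (0 : ℝ) 1) : transMat G w ∈ Matrix.rowStochastic ℝ (Fin N) := by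
  rw [transMat, div_eq_mul_inv, mul_smul]
  exact Matrix.convex_rowStochastic (metropolis_mem_rowStochastic h_loop)
    (inv_smul_onesMat_mem_rowStochastic N) (sub_nonneg.2 hw.2) hw.1 (sub_add_cancel 1 w)

theorem transMat_apply (w : ℝ) (i j : Fin N) :
    transMat G w i j = (1 - w) * metropolis G i j + w / N := by
  simp [transMat, onesMat]

theorem isIrreducible_transMat (h_loop : ∀ i, ¬ G.Adj i i) (h_dangling : ∀ i, ∃ j, G.Adj i j)
    {w : ℝ} (hw : w ∈ Set.Icc (0 : ℝ) 1) (h_conn : w = 0 → StronglyConnected G) :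
    (transMat G w).IsIrreducible := by
  have hmet := (metropolis_mem_rowStochastic h_loop).1
  have hw' : 0 ≤ 1 - w := sub_nonneg.2 hw.2
  have hnonneg (i j : Fin N) : 0 ≤ transMat G w i j := by
    rw [transMat_apply]
    exact add_nonneg (mul_nonneg hw' (hmet i j)) (div_nonneg hw.1 N.cast_nonneg)
  refine isIrreducible_of_transGen hnonneg fun i j => ?_
  rcases hw.1.eq_or_lt with hw₀ | hw₀
  · have hlink {a b : Fin N} (hab : G.Adj a b) : 0 < transMat G w a b := by
      have hne : a ≠ b := by
        rintro rfl
        exact h_loop a hab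
      rw [transMat_apply, ← hw₀]
      simpa [metropolis, hne] using linkWeight_pos hab
    exact Relation.TransGen.mono (fun _ _ => hlink) i j ((h_conn hw₀.symm).transGen h_dangling i j)
  · refine .single ?_
    have hN : (0 : ℝ) < N := Nat.cast_pos.2 i.pos
    rw [transMat_apply]
    exact add_pos_of_nonneg_of_pos (mul_nonneg hw' (hmet i j)) (div_pos hw₀ hN)

end TransitionMatrix

section Error

variable {N : ℕ} {G : Digraph (Fin N)} [DecidableRel G.Adj] {m : ℝ}

variable (G m) in
/-- The effect on the error `x(k) - x` of one step of the algorithm at node `i`. -/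
noncomputable def errorMap (i : Fin N) : EuclideanSpace ℝ (Fin N) →L[ℝ] EuclideanSpace ℝ (Fin N) :=
  relaxedProjection (1 / N) (WithLp.toLp 2 (regRow G m i))

theorem toLp_iter_sub {x : Fin N → ℝ} (hx : ∀ i, regRow G m i ⬝ᵥ x = m / N) (σ : ℕ → Fin N)
    (k : ℕ) : WithLp.toLp 2 (iter G m σ k - x) =
      trajectory (errorMap G m) (WithLp.toLp 2 (-x)) σ k := by
  induction k with
  | zero => simp [iter, trajectory]
  | succ k ih =>
    rw [trajectory, ← ih, errorMap, relaxedProjection_apply, EuclideanSpace.inner_toLp_toLp,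
      star_trivial, dotProduct_comm, dotProduct_sub, hx, ← WithLp.toLp_smul, ← WithLp.toLp_sub,
      iter, ← neg_sub (m / (N : ℝ)), mul_neg, neg_smul, sub_neg_eq_add, add_sub_right_comm]

theorem isParacontracting_errorMap (h_dangling : ∀ i, ∃ j, G.Adj i j)
    (hm : m ∈ Set.Icc (0 : ℝ) 1) (i : Fin N) : IsParacontracting (errorMap G m i) := by
  have hN : (0 : ℝ) < N := Nat.cast_pos.2 i.pos
  refine isParacontracting_relaxedProjection (one_div_pos.2 hN) ?_
  rw [one_div_mul_eq_div, div_lt_iff₀ hN]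
  linarith [norm_sq_regRow_le h_dangling hm i]

theorem eq_zero_of_forall_errorMap_eq_self (h_dangling : ∀ i, ∃ j, G.Adj i j)
    (hm : m ∈ Set.Ioc (0 : ℝ) 1) {v : EuclideanSpace ℝ (Fin N)}
    (hv : ∀ i, errorMap G m i v = v) : v = 0 := by
  have horth : (1 - (1 - m) • hyperlink G) *ᵥ v.ofLp = 0 := by
    rw [one_sub_smul_hyperlink_mulVec]
    ext i
    have hη : 1 / (N : ℝ) ≠ 0 := one_div_ne_zero (Nat.cast_ne_zero.2 i.pos.ne')
    have hinner := (relaxedProjection_eq_self_iff hη).1 (hv i)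
    rwa [← WithLp.toLp_ofLp 2 v, EuclideanSpace.inner_toLp_toLp, star_trivial,
      dotProduct_comm] at hinner
  exact (WithLp.ofLp_eq_zero 2).1 (Matrix.eq_zero_of_mulVec_eq_zero
    (det_one_sub_smul_hyperlink_ne_zero h_dangling hm) horth)

end Error

section Convergence

theorem exists_norm_toLp_le_mul_norm_toLp (ι : Type*) [Fintype ι] (p q : ℝ≥0∞) [Fact (1 ≤ p)]
    [Fact (1 ≤ q)] : ∃ K > 0, ∀ v : ι → ℝ, ‖WithLp.toLp p v‖ ≤ K * ‖WithLp.toLp q v‖ := by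
  let e : WithLp q (ι → ℝ) ≃ₗ[ℝ] WithLp p (ι → ℝ) :=
    (WithLp.linearEquiv q ℝ (ι → ℝ)).trans (WithLp.linearEquiv p ℝ (ι → ℝ)).symm
  obtain ⟨K, hK, hbound⟩ := e.toLinearMap.toContinuousLinearMap.bound
  exact ⟨K, hK, fun v => hbound (WithLp.toLp q v)⟩

variable {N : ℕ} {G : Digraph (Fin N)} [DecidableRel G.Adj] {m : ℝ} {Ω : Type*}
  [MeasurableSpace Ω] {μ : Measure Ω} [IsProbabilityMeasure μ] {P : Matrix (Fin N) (Fin N) ℝ}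
  {s : ℕ → Ω → Fin N} {x : Fin N → ℝ}

theorem exists_ae_eventually_norm_iter_sub_le (h_dangling : ∀ i, ∃ j, G.Adj i j)
    (hm : m ∈ Set.Ioc (0 : ℝ) 1) (hs : IsMarkovChain μ P s)
    (hP : P ∈ Matrix.rowStochastic ℝ (Fin N)) (hirr : P.IsIrreducible)
    (hx : ∀ i, regRow G m i ⬝ᵥ x = m / N) :
    ∃ ρ ∈ Set.Ioo (0 : ℝ) 1, ∀ᵐ a ∂μ, ∀ᶠ k in atTop,
      ‖WithLp.toLp 2 (iter G m (fun t => s t a) k - x)‖ ≤ ρ ^ k := by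
  simp only [toLp_iter_sub hx]
  exact hs.exists_ae_eventually_norm_trajectory_le hP hirr
    (isParacontracting_errorMap h_dangling (Set.Ioc_subset_Icc_self hm))
    (fun _ => eq_zero_of_forall_errorMap_eq_self h_dangling hm) _

theorem exists_eLpNorm_iter_sub_le (h_dangling : ∀ i, ∃ j, G.Adj i j) (hm : m ∈ Set.Ioc (0 : ℝ) 1)
    (hs : IsMarkovChain μ P s) (hP : P ∈ Matrix.rowStochastic ℝ (Fin N)) (hirr : P.IsIrreducible)
    (hx : ∀ i, regRow G m i ⬝ᵥ x = m / N) {p : ℝ≥0∞} (hp₁ : 1 ≤ p) (hp₂ : p ≤ 2) :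
    ∃ M > (0 : ℝ), ∃ ρ ∈ Set.Ioo (0 : ℝ) 1, ∀ k,
      eLpNorm (fun a => ‖WithLp.toLp p (iter G m (fun t => s t a) k - x)‖) p μ ≤
        ENNReal.ofReal (M * ρ ^ k) := by
  have : Fact (1 ≤ p) := ⟨hp₁⟩
  obtain ⟨K, hK, hnorm⟩ := exists_norm_toLp_le_mul_norm_toLp (Fin N) p 2
  obtain ⟨M, hM, ρ, hρ, hdecay⟩ := hs.exists_eLpNorm_norm_trajectory_le hP hirr
    (isParacontracting_errorMap h_dangling (Set.Ioc_subset_Icc_self hm))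
    (fun _ => eq_zero_of_forall_errorMap_eq_self h_dangling hm) (WithLp.toLp 2 (-x))
  simp only [← toLp_iter_sub hx] at hdecay
  refine ⟨K * M, mul_pos hK hM, ρ, hρ, fun k => ?_⟩
  calc eLpNorm (fun a => ‖WithLp.toLp p (iter G m (fun t => s t a) k - x)‖) p μ
      ≤ ENNReal.ofReal K *
          eLpNorm (fun a => ‖WithLp.toLp 2 (iter G m (fun t => s t a) k - x)‖) p μ :=
        eLpNorm_le_mul_eLpNorm_of_ae_le_mul
          (.of_forall fun a => by simpa only [norm_norm] using hnorm _) p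
    _ ≤ ENNReal.ofReal K * ENNReal.ofReal (M * ρ ^ k) := by
        gcongr
        exact hdecay k p hp₂
    _ = ENNReal.ofReal (K * M * ρ ^ k) := by rw [← ENNReal.ofReal_mul hK.le, mul_assoc]

end Convergence

end PageRank

theorem theorem1_general {N : ℕ} (G : Digraph (Fin N)) [DecidableRel G.Adj]
    (h_dangling : ∀ i, ∃ j, G.Adj i j) (m : ℝ) (hm : m ∈ Set.Ioc (0 : ℝ) 1)
    (P : Matrix (Fin N) (Fin N) ℝ) (hP : P ∈ Matrix.rowStochastic ℝ (Fin N))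
    (hirr : P.IsIrreducible) {Ω : Type*} [MeasurableSpace Ω] (μ : MeasureTheory.Measure Ω)
    [MeasureTheory.IsProbabilityMeasure μ] (s : ℕ → Ω → Fin N)
    (hs : PageRank.IsMarkovChain μ P s) :
    (∃! x : Fin N → ℝ, PageRank.IsPageRank G m x) ∧
    ∀ x : Fin N → ℝ, PageRank.IsPageRank G m x →
      (∃ M₁ > (0 : ℝ), ∃ ρ₁ ∈ Set.Ioo (0 : ℝ) 1, ∀ᵐ a ∂μ, ∃ k₀ : ℕ, 0 < k₀ ∧ ∀ k > k₀,
        ‖(WithLp.toLp 2 (PageRank.iter G m (fun t => s t a) k - x) :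
          EuclideanSpace ℝ (Fin N))‖ ≤ M₁ * ρ₁ ^ k) ∧
      (∀ p : ℝ≥0∞, 1 ≤ p → p ≤ 2 →
        ∃ M₂ > (0 : ℝ), ∃ ρ₂ ∈ Set.Ioo (0 : ℝ) 1, ∀ k : ℕ, 0 < k →
          MeasureTheory.eLpNorm (fun a =>
            ‖(WithLp.toLp p (PageRank.iter G m (fun t => s t a) k - x) :
              PiLp p fun _ : Fin N => ℝ)‖) p μ ≤ ENNReal.ofReal (M₂ * ρ₂ ^ k)) := by
  have hN : 0 < N := by
    obtain ⟨a⟩ := μ.nonempty_of_neZero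
    exact (s 0 a).pos
  refine ⟨PageRank.existsUnique_isPageRank h_dangling hN hm, fun x hx => ?_⟩
  rw [PageRank.isPageRank_iff h_dangling hN hm.1.ne'] at hx
  constructor
  · obtain ⟨ρ, hρ, hae⟩ :=
      PageRank.exists_ae_eventually_norm_iter_sub_le h_dangling hm hs hP hirr hx
    refine ⟨1, one_pos, ρ, hρ, hae.mono fun a ha => ?_⟩
    obtain ⟨k₀, hk₀⟩ := Filter.eventually_atTop.1 ha
    refine ⟨k₀ + 1, k₀.succ_pos, fun k hk => ?_⟩
    rw [one_mul]
    exact hk₀ k (by omega)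
  · intro p hp₁ hp₂
    obtain ⟨M, hM, ρ, hρ, hdecay⟩ :=
      PageRank.exists_eLpNorm_iter_sub_le h_dangling hm hs hP hirr hx hp₁ hp₂
    exact ⟨M, hM, ρ, hρ, fun k _ => hdecay k⟩

theorem theorem1 {N : ℕ} (G : Digraph (Fin N)) [DecidableRel G.Adj]
    (h_loop : ∀ i, ¬ G.Adj i i) (h_dangling : ∀ i, ∃ j, G.Adj i j)
    (m : ℝ) (hm : m ∈ Set.Ioo (0 : ℝ) 1) (w : ℝ) (hw : w ∈ Set.Icc (0 : ℝ) 1)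
    (h_conn : w = 0 → PageRank.StronglyConnected G)
    {Ω : Type*} [MeasurableSpace Ω] (μ : MeasureTheory.Measure Ω)
    [MeasureTheory.IsProbabilityMeasure μ] (s : ℕ → Ω → Fin N)
    (hs : PageRank.IsMarkovChain μ (PageRank.transMat G w) s) :
    (∃! x : Fin N → ℝ, PageRank.IsPageRank G m x) ∧
    ∀ x : Fin N → ℝ, PageRank.IsPageRank G m x →
      (∃ M₁ > (0 : ℝ), ∃ ρ₁ ∈ Set.Ioo (0 : ℝ) 1, ∀ᵐ a ∂μ, ∃ k₀ : ℕ, 0 < k₀ ∧ ∀ k > k₀,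
        ‖(WithLp.toLp 2 (PageRank.iter G m (fun t => s t a) k - x) :
          EuclideanSpace ℝ (Fin N))‖ ≤ M₁ * ρ₁ ^ k) ∧
      (∀ p : ℝ≥0∞, 1 ≤ p → p ≤ 2 →
        ∃ M₂ > (0 : ℝ), ∃ ρ₂ ∈ Set.Ioo (0 : ℝ) 1, ∀ k : ℕ, 0 < k →
          MeasureTheory.eLpNorm (fun a =>
            ‖(WithLp.toLp p (PageRank.iter G m (fun t => s t a) k - x) :
              PiLp p fun _ : Fin N => ℝ)‖) p μ ≤ ENNReal.ofReal (M₂ * ρ₂ ^ k)) :=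
  theorem1_general G h_dangling m (Set.Ioo_subset_Ioc_self hm) _
    (PageRank.transMat_mem_rowStochastic h_loop hw)
    (PageRank.isIrreducible_transMat h_loop h_dangling hw h_conn) μ s hs
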